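/- Let $n\ge 1$ and $k\ge 2$ be integers. For a permutation $\sigma$ of $\{1,\dots,n\}$ let $$C_\sigma=\{\beta\in\mathbb R^n:\ \beta_{\sigma(1)}\ge\beta_{\sigma(2)}\ge\dots\ge\beta_{\sigma(n)}\}$$ be the corresponding closed Weyl chamber of type $A_{n-1}$, and let $\mathcal F_k(C_\sigma)$ be the (finite) set of its $k$-dimensional faces, the dimension of a face being the dimension of its linear span. Let $L\subset\mathbb R^n$ be a linear subspace of codimension $d$ in general position with respect to the arrangement of the hyperplanes $\{\beta_i=\beta_j\}$, $1\le i<j\le n$; that is, for every linear subspace $K$ that is an intersection of some of these hyperplanes (the empty intersection being $\mathbb R^n$), $\dim(L\cap K)=\dim K-d$ if $\dim K\ge d$, and $\dim(L\cap K)=0$ if $\dim K\le d$. Then $$\frac1{n!}\sum_{\sigma\in\mathrm{Sym}(n)}\#\{F\in\mathcal F_k(C_\sigma):\ F\cap L=\{0\}\}=\frac{2}{k!}\binom{n-1}{k-1}\left(\left[{k\atop d-1}\right]+\left[{k\atop d-3}\right]+\cdots\right),$$ where the $\left[{k\atop j}\right]$ are the (unsigned) Stirling numbers of the first kind, defined by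 $t(t+1)\cdots(t+k-1)=\sum_{j=1}^{k}\left[{k\atop j}\right]t^j$, with $\left[{k\atop j}\right]=0$ for $j\le 0$ and for $j>k$. -/

import Mathlib

/-- The closed Weyl chamber of type `A_{n-1}` attached to a permutation `σ`:
all `β` with `β_{σ(1)} ≥ β_{σ(2)} ≥ … ≥ β_{σ(n)}`. -/
def weylChamberA {n : ℕ} (σ : Equiv.Perm (Fin n)) : PointedCone ℝ (Fin n → ℝ) where
  carrier := {β | ∀ i j : Fin n, i ≤ j → β (σ j) ≤ β (σ i)}
  add_mem' := fun ha hb i j hij => add_le_add (ha i j hij) (hb i j hij)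
  zero_mem' := fun _ _ _ => le_refl _
  smul_mem' := fun c _ hb i j hij => mul_le_mul_of_nonneg_left (hb i j hij) c.2

/-- The hyperplane `{β : β_i = β_j}` in `ℝⁿ`. -/
def equalCoordHyperplane {n : ℕ} (i j : Fin n) : Submodule ℝ (Fin n → ℝ) where
  carrier := {β | β i = β j}
  add_mem' := fun ha hb => congrArg₂ (· + ·) ha hb
  zero_mem' := rfl
  smul_mem' := fun c _ hb => congrArg (c * ·) hb

/-- The reflection (braid) arrangement of type `A_{n-1}`: all hyperplanes `{β_i = β_j}`, `i < j`. -/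
def reflectionArrangementA (n : ℕ) : Set (Submodule ℝ (Fin n → ℝ)) :=
  {H | ∃ i j : Fin n, i < j ∧ H = equalCoordHyperplane i j}

/-- The lattice generated by a set of hyperplanes: all intersections of some of them
(the empty intersection being the whole space). -/
def arrangementLattice {V : Type*} [AddCommGroup V] [Module ℝ V]
    (A : Set (Submodule ℝ V)) : Set (Submodule ℝ V) :=
  {K | ∃ S ⊆ A, K = sInf S}

/-- A linear subspace `L` of codimension `d` is in general position with respect to the
arrangement `A` if, for every `K` in the lattice of `A`, the dimension of `L ∩ K` is
`dim K - d` when `dim K ≥ d` and `0` when `dim K ≤ d`. -/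
def InGeneralPosition {V : Type*} [AddCommGroup V] [Module ℝ V]
    (A : Set (Submodule ℝ V)) (L : Submodule ℝ V) (d : ℕ) : Prop :=
  ∀ K ∈ arrangementLattice A,
    (d ≤ Module.finrank ℝ K → Module.finrank ℝ ↥(L ⊓ K) = Module.finrank ℝ K - d) ∧
    (Module.finrank ℝ K ≤ d → Module.finrank ℝ ↥(L ⊓ K) = 0)

/-- The set of `k`-dimensional faces of a convex cone `C`; the dimension of a face is the
dimension of its linear span. -/
def facesOfDim {V : Type*} [AddCommGroup V] [Module ℝ V]
    (k : ℕ) (C : PointedCone ℝ V) : Set (PointedCone ℝ V) :=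
  {F | F.IsFaceOf C ∧ Module.finrank ℝ (Submodule.span ℝ (F : Set V)) = k}

/-! A `k`-face of the chamber of `σ` is a cone `{γ ∘ f : γ antitone}` for a unique surjection `f :
Fin n → Fin k` with `f ∘ σ` monotone (`facesOfDim_weylChamberA`, `levelCone_injOn`). Exchanging
sums, each `f` counts with weight `w f`, the number of `σ` making `f ∘ σ` monotone. This weight is
the order of the stabilizer of `f`, so relabelling values by `Sym(k)` does not change it. The `k!`
relabellings of one `f` give cones that tile the `k`-dimensional span of its face as the Weyl
chambers of type `A_{k-1}`, and `L` stays generic there. So the average reduces to counting the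
chambers in `ℝ^k` that a generic subspace meets only in `0`; the total weight is `n! * choose (n-1)
(k-1)`.

Such a subspace meets a chamber nontrivially exactly when it meets its interior
(`GenericForBraid.exists_strictAnti`), so the chambers it does meet are the regions cut out on it. A
Zaslavsky-type formula by deletion-restriction (`regionCount_map_coordDiff`) counts these from the
coefficients of `q(q-1)⋯(q-k+1)`, giving twice the sum of the Stirling numbers at `d+1, d+3, …`.
Evaluating the rising factorial at `1` and `-1` turns the complement in `k!` into the sum at `d-1,
d-3, …`. -/

/-! ### Regions of a list of functionals -/

section Regions

variable {V : Type*} [NormedAddCommGroup V] [NormedSpace ℝ V]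

open Classical in
/-- The number of sign vectors in `{+, -}^A` that the list of functionals `A` realizes on `U`. -/
noncomputable def regionCount : List (V →L[ℝ] ℝ) → Set V → ℕ
  | [], U => if U.Nonempty then 1 else 0
  | l :: A, U => regionCount A (U ∩ {v | 0 < l v}) + regionCount A (U ∩ {v | l v < 0})

lemma regionCount_empty (A : List (V →L[ℝ] ℝ)) : regionCount A ∅ = 0 := by
  induction A with
  | nil => simp [regionCount]
  | cons l A ih => simp [regionCount, ih]

lemma regionCount_swap (l m : V →L[ℝ] ℝ) (A : List (V →L[ℝ] ℝ)) (U : Set V) :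
    regionCount (l :: m :: A) U = regionCount (m :: l :: A) U := by
  simp only [regionCount, Set.inter_right_comm U {v | 0 < l v}, Set.inter_right_comm U {v | l v < 0}]
  ring

/-- Near a point of an open set, one can move slightly in any direction. -/
lemma IsOpen.exists_pos_add_smul_mem {O : Set V} (hO : IsOpen O) {x : V} (hx : x ∈ O) (m : V) :
    ∃ ε : ℝ, 0 < ε ∧ x + ε • m ∈ O := by
  have hc : Continuous fun ε : ℝ => x + ε • m := by fun_prop
  have h0 : ∀ᶠ ε in nhds (0 : ℝ), x + ε • m ∈ O :=
    hc.continuousAt.eventually (hO.mem_nhds (by simpa using hx))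
  obtain ⟨ε, h, hε⟩ := ((h0.filter_mono nhdsWithin_le_nhds).and
    (self_mem_nhdsWithin : Set.Ioi (0 : ℝ) ∈ nhdsWithin 0 (Set.Ioi 0))).exists
  exact ⟨ε, hε, h⟩

/-- If `l` vanishes somewhere on `M ∩ O`, moving by small multiples of `±m` reaches both sides;
otherwise convexity forces a constant sign. -/
lemma regionCount_singleton {M : Submodule ℝ V} {O : Set V} (hO : IsOpen O) (hc : Convex ℝ O)
    (l : V →L[ℝ] ℝ) {m : V} (hm : m ∈ M) (hlm : 0 < l m) :
    regionCount [l] ((M : Set V) ∩ O) = regionCount [] ((M : Set V) ∩ O) +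
      regionCount [] (((M ⊓ l.ker : Submodule ℝ V) : Set V) ∩ O) := by
  simp only [regionCount]
  by_cases h : ∃ x ∈ M, x ∈ O ∧ l x = 0
  · obtain ⟨x, hxM, hxO, hx⟩ := h
    obtain ⟨ε, hε, h1⟩ := hO.exists_pos_add_smul_mem hxO m
    obtain ⟨δ, hδ, h2⟩ := hO.exists_pos_add_smul_mem hxO (-m)
    rw [if_pos ⟨_, ⟨M.add_mem hxM (M.smul_mem ε hm), h1⟩, by simp [hx]; positivity⟩,
      if_pos ⟨_, ⟨M.add_mem hxM (M.smul_mem δ (M.neg_mem hm)), h2⟩, by simp [hx]; positivity⟩,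
      if_pos ⟨x, hxM, hxO⟩, if_pos ⟨x, ⟨hxM, hx⟩, hxO⟩]
  · rw [if_neg (c := (((M ⊓ l.ker : Submodule ℝ V) : Set V) ∩ O).Nonempty)
      fun ⟨x, hx, hxO⟩ => h ⟨x, hx.1, hxO, hx.2⟩]
    have key : ∀ x ∈ (M : Set V) ∩ O, ∀ y ∈ (M : Set V) ∩ O, 0 < l x → l y < 0 → False := by
      intro x hx y hy h1 h2
      have hs : 0 < l x - l y := by linarith
      -- The zero of `l` on the segment from `x` to `y`.
      refine h ⟨(-l y / (l x - l y)) • x + (l x / (l x - l y)) • y,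
        M.add_mem (M.smul_mem _ hx.1) (M.smul_mem _ hy.1),
        hc hx.2 hy.2 (div_nonneg (by linarith) hs.le) (by positivity) ?_, ?_⟩
      · field_simp
        ring
      · simp only [map_add, map_smul, smul_eq_mul]
        field_simp
        ring
    by_cases hU : ((M : Set V) ∩ O).Nonempty
    · obtain ⟨x, hx⟩ := hU
      rw [if_pos (c := ((M : Set V) ∩ O).Nonempty) ⟨x, hx⟩]
      have hx0 : l x ≠ 0 := fun h0 => h ⟨x, hx.1, hx.2, h0⟩
      rcases lt_or_gt_of_ne hx0 with h1 | h1
      · rw [if_neg (c := ((M : Set V) ∩ O ∩ {v | 0 < l v}).Nonempty)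
            fun ⟨y, hy, h2⟩ => key y hy x hx h2 h1, if_pos ⟨x, hx, h1⟩]
      · rw [if_pos (c := ((M : Set V) ∩ O ∩ {v | 0 < l v}).Nonempty) ⟨x, hx, h1⟩,
          if_neg fun ⟨y, hy, h2⟩ => key x hx y hy h1 h2]
    · rw [Set.not_nonempty_iff_eq_empty] at hU
      simp [hU]

/-- Deletion-restriction for the number of regions. -/
lemma regionCount_cons (A : List (V →L[ℝ] ℝ)) {M : Submodule ℝ V} {O : Set V} (hO : IsOpen O)
    (hc : Convex ℝ O) (l : V →L[ℝ] ℝ) (hl : ¬ M ≤ l.ker) :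
    regionCount (l :: A) ((M : Set V) ∩ O) = regionCount A ((M : Set V) ∩ O) +
      regionCount A (((M ⊓ l.ker : Submodule ℝ V) : Set V) ∩ O) := by
  obtain ⟨m, hm, hlm⟩ : ∃ m ∈ M, 0 < l m := by
    obtain ⟨m, hm, h0⟩ := SetLike.not_le_iff_exists.1 hl
    rcases lt_or_gt_of_ne (show l m ≠ 0 from h0) with h | h
    · exact ⟨-m, M.neg_mem hm, by simpa using h⟩
    · exact ⟨m, hm, h⟩
  -- Splitting by another functional replaces `O` by its intersection with an open half-space, still
  -- open and convex.
  induction A generalizing O with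
  | nil => exact regionCount_singleton hO hc l hm hlm
  | cons a A ih =>
    rw [regionCount_swap, regionCount, Set.inter_assoc, Set.inter_assoc,
      ih (hO.inter (isOpen_lt continuous_const a.continuous))
        (hc.inter (convex_halfSpace_gt a.isLinear 0)),
      ih (hO.inter (isOpen_lt a.continuous continuous_const))
        (hc.inter (convex_halfSpace_lt a.isLinear 0)), regionCount, regionCount]
    simp only [Set.inter_assoc]
    ring

lemma regionCount_cons_of_le_ker (A : List (V →L[ℝ] ℝ)) {U : Set V} (l : V →L[ℝ] ℝ)
    (hl : ∀ v ∈ U, l v = 0) : regionCount (l :: A) U = 0 := by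
  have h1 : U ∩ {v | 0 < l v} = ∅ := by
    ext v; simp only [Set.mem_inter_iff, Set.mem_ofPred_eq, Set.mem_empty_iff_false, iff_false]
    rintro ⟨hv, h⟩; exact h.ne' (hl v hv)
  have h2 : U ∩ {v | l v < 0} = ∅ := by
    ext v; simp only [Set.mem_inter_iff, Set.mem_ofPred_eq, Set.mem_empty_iff_false, iff_false]
    rintro ⟨hv, h⟩; exact h.ne (hl v hv)
  rw [regionCount, h1, h2, regionCount_empty]

/-- `regionCount` is the number of sign patterns. -/
lemma regionCount_eq_ncard (A : List (V →L[ℝ] ℝ)) (U : Set V) :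
    regionCount A U = Set.ncard ((fun v => A.map fun l => decide (0 < l v)) ''
      {v ∈ U | ∀ l ∈ A, l v ≠ 0}) ∧ ((fun v => A.map fun l => decide (0 < l v)) ''
      {v ∈ U | ∀ l ∈ A, l v ≠ 0}).Finite := by
  induction A generalizing U with
  | nil =>
    by_cases h : U.Nonempty
    · simp [regionCount, h]
    · simp [regionCount, Set.not_nonempty_iff_eq_empty.1 h]
  | cons l A ih =>
    have key : ((fun v => (l :: A).map fun l => decide (0 < l v)) ''
      {v ∈ U | ∀ m ∈ l :: A, m v ≠ 0}) = (List.cons true ''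
        ((fun v => A.map fun l => decide (0 < l v)) ''
          {v ∈ U ∩ {v | 0 < l v} | ∀ l ∈ A, l v ≠ 0})) ∪ (List.cons false ''
        ((fun v => A.map fun l => decide (0 < l v)) ''
          {v ∈ U ∩ {v | l v < 0} | ∀ l ∈ A, l v ≠ 0})) := by
      ext s
      constructor
      · rintro ⟨v, ⟨hv, h⟩, rfl⟩
        rcases lt_or_gt_of_ne (h l (by simp)) with h0 | h0
        · refine Or.inr ⟨_, ⟨v, ⟨⟨hv, h0⟩, fun m hm => h m (by simp [hm])⟩, rfl⟩, ?_⟩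
          simp [h0.le]
        · refine Or.inl ⟨_, ⟨v, ⟨⟨hv, h0⟩, fun m hm => h m (by simp [hm])⟩, rfl⟩, ?_⟩
          simp [h0]
      · rintro (⟨_, ⟨v, ⟨⟨hv, h0⟩, h⟩, rfl⟩, rfl⟩ | ⟨_, ⟨v, ⟨⟨hv, h0⟩, h⟩, rfl⟩, rfl⟩)
        · refine ⟨v, ⟨hv, ?_⟩, ?_⟩
          · simpa using ⟨(show 0 < l v from h0).ne', h⟩
          · simpa using h0
        · refine ⟨v, ⟨hv, ?_⟩, ?_⟩
          · simpa using ⟨(show l v < 0 from h0).ne, h⟩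
          · simpa using (show l v < 0 from h0).le
    obtain ⟨h1, f1⟩ := ih (U ∩ {v | 0 < l v})
    obtain ⟨h2, f2⟩ := ih (U ∩ {v | l v < 0})
    rw [key]
    refine ⟨?_, (f1.image _).union (f2.image _)⟩
    rw [Set.ncard_union_eq ?_ (f1.image _) (f2.image _),
      Set.ncard_image_of_injective _ List.cons_injective,
      Set.ncard_image_of_injective _ List.cons_injective, regionCount, h1, h2]
    rw [Set.disjoint_left]
    rintro _ ⟨s, -, rfl⟩ ⟨t, -, h⟩
    simp at h

end Regions

/-! ### Flats of the braid arrangement and generic sections -/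

section Flats

variable {ι : Type*}

/-- The subspace of vectors whose coordinates agree along every pair in `S`. -/
def braidFlat (S : Set (ι × ι)) : Submodule ℝ (ι → ℝ) where
  carrier := {β | ∀ e ∈ S, β e.1 = β e.2}
  add_mem' := fun ha hb e he => congrArg₂ (· + ·) (ha e he) (hb e he)
  zero_mem' := fun _ _ => rfl
  smul_mem' := fun c _ hb e he => congrArg (c * ·) (hb e he)

/-- The functional `β ↦ β_i - β_j`. -/
noncomputable def coordDiff (e : ι × ι) : (ι → ℝ) →L[ℝ] ℝ :=
  ContinuousLinearMap.proj (R := ℝ) (φ := fun _ : ι => ℝ) e.1 - ContinuousLinearMap.proj e.2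

@[simp] lemma coordDiff_apply (e : ι × ι) (β : ι → ℝ) : coordDiff e β = β e.1 - β e.2 := rfl

lemma braidFlat_insert (e : ι × ι) (S : Set (ι × ι)) :
    braidFlat (insert e S) = braidFlat S ⊓ (coordDiff e).ker := by
  ext β
  change (∀ x ∈ insert e S, β x.1 = β x.2) ↔ (∀ x ∈ S, β x.1 = β x.2) ∧ β e.1 - β e.2 = 0
  rw [Set.forall_mem_insert, sub_eq_zero, and_comm]

lemma Submodule.finrank_inf_ker_add_one {V : Type*} [AddCommGroup V] [Module ℝ V]
    [FiniteDimensional ℝ V] (M : Submodule ℝ V) (l : V →ₗ[ℝ] ℝ) (hl : ¬ M ≤ LinearMap.ker l) :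
    Module.finrank ℝ (M ⊓ LinearMap.ker l : Submodule ℝ V) + 1 = Module.finrank ℝ M := by
  have h0 : l.domRestrict M ≠ 0 := by
    intro h
    refine hl fun x hx => ?_
    simpa using LinearMap.congr_fun h ⟨x, hx⟩
  have h1 := (l.domRestrict M).finrank_range_add_finrank_ker
  rw [LinearMap.range_eq_top.2 (LinearMap.surjective_of_ne_zero h0), finrank_top,
    Module.finrank_self] at h1
  have h2 : (LinearMap.ker (l.domRestrict M)).map M.subtype = M ⊓ LinearMap.ker l := by
    ext x
    simp [and_comm]
  rw [← h2, ← (Submodule.equivMapOfInjective M.subtype M.injective_subtype _).finrank_eq]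
  omega

/-- `L` meets every flat of the braid arrangement in the expected dimension. -/
def GenericForBraid (L : Submodule ℝ (ι → ℝ)) (d : ℕ) : Prop :=
  ∀ S : Set (ι × ι), Module.finrank ℝ (L ⊓ braidFlat S : Submodule ℝ (ι → ℝ)) =
    Module.finrank ℝ (braidFlat S) - d

/-- The characteristic polynomial of the arrangement of the pairs in `A`, restricted to the
flat of `S`. -/
noncomputable def braidCharpoly : List (ι × ι) → Set (ι × ι) → Polynomial ℤ
  | [], S => Polynomial.X ^ Module.finrank ℝ (braidFlat S)
  | e :: A, S => braidCharpoly A S - braidCharpoly A (insert e S)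

/-- With `X = ℝ` this gives the dimension of a flat, with `X = Fin q` its number of colourings, both
through the same quotient. -/
lemma range_comp_quot_mk {X : Type*} (S : Set (ι × ι)) :
    Set.range (fun g : Quot (fun i j => (i, j) ∈ S) → X => g ∘ Quot.mk _) =
      {c : ι → X | ∀ e ∈ S, c e.1 = c e.2} := by
  ext c
  constructor
  · rintro ⟨g, rfl⟩ ⟨i, j⟩ he
    exact congrArg g (Quot.sound he)
  · intro hc
    exact ⟨Quot.lift c fun i j h => hc (i, j) h, rfl⟩

variable [Fintype ι]

lemma finrank_braidFlat (S : Set (ι × ι)) :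
    Module.finrank ℝ (braidFlat S) = Nat.card (Quot (fun i j => (i, j) ∈ S)) := by
  have : Finite (Quot (fun i j => (i, j) ∈ S)) := Quot.finite _
  have := Fintype.ofFinite (Quot (fun i j => (i, j) ∈ S))
  have h : LinearMap.range (LinearMap.funLeft ℝ ℝ (Quot.mk (fun i j => (i, j) ∈ S))) =
      braidFlat S := SetLike.coe_injective (range_comp_quot_mk S)
  rw [← h, LinearMap.finrank_range_of_inj
    (LinearMap.funLeft_injective_of_surjective _ _ _ Quot.mk_surjective),
    Module.finrank_fintype_fun_eq_card, Nat.card_eq_fintype_card]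

/-- The characteristic polynomial counts colourings. -/
lemma braidCharpoly_eval (q : ℕ) (A : List (ι × ι)) (S : Set (ι × ι)) :
    (braidCharpoly A S).eval (q : ℤ) = Set.ncard {c : ι → Fin q | (∀ e ∈ S, c e.1 = c e.2) ∧
      ∀ e ∈ A, c e.1 ≠ c e.2} := by
  induction A generalizing S with
  | nil =>
    simp only [List.not_mem_nil, false_imp_iff, implies_true, and_true]
    have : Finite (Quot (fun i j => (i, j) ∈ S)) := Quot.finite _
    rw [← range_comp_quot_mk, ← Set.image_univ, Set.ncard_image_of_injective _
      (Function.Surjective.injective_comp_right Quot.mk_surjective), Set.ncard_univ, Nat.card_fun,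
      Nat.card_fin, braidCharpoly, finrank_braidFlat]
    simp
  | cons e A ih =>
    rw [braidCharpoly, Polynomial.eval_sub, ih, ih, sub_eq_iff_eq_add]
    norm_cast
    rw [add_comm, ← Set.ncard_inter_add_ncard_sdiff_eq_ncard _ {c : ι → Fin q | c e.1 = c e.2}
      (Set.toFinite _)]
    congr 2
    · ext c
      simp only [Set.mem_inter_iff, Set.mem_ofPred_eq, Set.forall_mem_insert]
      tauto
    · ext c
      simp only [Set.mem_sdiff, Set.mem_ofPred_eq, List.forall_mem_cons]
      tauto

/-- Twice the sum of the coefficients in degrees `d + 1, d + 3, …`. -/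
def alternateUpperSum (N d : ℕ) (p : Polynomial ℤ) : ℤ :=
  2 * ∑ j ∈ (Finset.range (N + 1)).filter (fun j => d < j ∧ Odd (j - d)), p.coeff j

lemma alternateUpperSum_sub (N d : ℕ) (p q : Polynomial ℤ) :
    alternateUpperSum N d (p - q) = alternateUpperSum N d p - alternateUpperSum N d q := by
  simp [alternateUpperSum, mul_sub]

open Classical in
lemma alternateUpperSum_X_pow {N d m : ℕ} (hm : m ≤ N) :
    alternateUpperSum N d (Polynomial.X ^ m) = if d < m ∧ Odd (m - d) then 2 else 0 := by
  simp only [alternateUpperSum, Polynomial.coeff_X_pow, Finset.sum_ite_eq']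
  simp [Nat.lt_succ_of_le hm]

/-- Both sides obey one recursion: region counts add, characteristic polynomials subtract, and the
sign flips because restriction lowers the dimension by one. The empty list is excluded: it always
has one region, while the right side is even. -/
lemma regionCount_map_coordDiff {L : Submodule ℝ (ι → ℝ)} {d : ℕ} (hL : GenericForBraid L d)
    {A : List (ι × ι)} (hA : A ≠ []) (S : Set (ι × ι)) :
    (regionCount (A.map coordDiff) ((L ⊓ braidFlat S : Submodule ℝ (ι → ℝ)) : Set (ι → ℝ)) : ℤ) =
      (-1) ^ (Module.finrank ℝ (braidFlat S) + d + 1) *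
        alternateUpperSum (Fintype.card ι) d (braidCharpoly A S) := by
  have zero_case : ∀ (e : ι × ι) (A : List (ι × ι)) (S : Set (ι × ι)),
      Module.finrank ℝ (braidFlat S) ≤ d →
      regionCount ((e :: A).map coordDiff)
        ((L ⊓ braidFlat S : Submodule ℝ (ι → ℝ)) : Set (ι → ℝ)) = 0 := by
    intro e A S h
    have h0 : L ⊓ braidFlat S = ⊥ := by
      rw [← Submodule.finrank_eq_zero (R := ℝ), hL S]; omega
    rw [h0, List.map_cons]
    refine regionCount_cons_of_le_ker _ _ fun v hv => ?_
    rw [(Submodule.mem_bot ℝ).1 hv, map_zero]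
  have step : ∀ (e : ι × ι) (A : List (ι × ι)) (S : Set (ι × ι)),
      ¬ braidFlat S ≤ (coordDiff e).ker → d < Module.finrank ℝ (braidFlat S) →
      regionCount ((e :: A).map coordDiff)
        ((L ⊓ braidFlat S : Submodule ℝ (ι → ℝ)) : Set (ι → ℝ)) =
      regionCount (A.map coordDiff) ((L ⊓ braidFlat S : Submodule ℝ (ι → ℝ)) : Set (ι → ℝ)) +
      regionCount (A.map coordDiff)
        ((L ⊓ braidFlat (insert e S) : Submodule ℝ (ι → ℝ)) : Set (ι → ℝ)) := by
    intro e A S h hd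
    have hdim := Submodule.finrank_inf_ker_add_one _ _ h
    -- Otherwise cutting by `e` would lower the dimension of the flat but not of its section,
    -- against genericity above dimension `d`.
    have h1 : ¬ L ⊓ braidFlat S ≤ (coordDiff e).ker := by
      intro hle
      have h2 := hL (insert e S)
      rw [braidFlat_insert, ← inf_assoc, inf_eq_left.2 hle, hL S] at h2
      change _ = Module.finrank ℝ (braidFlat S ⊓ LinearMap.ker _ : Submodule ℝ (ι → ℝ)) - d at h2
      omega
    have h3 := regionCount_cons (A.map coordDiff) isOpen_univ convex_univ (coordDiff e) h1
    rw [Set.inter_univ, Set.inter_univ, inf_assoc, ← braidFlat_insert] at h3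
    exact h3
  have rank_insert : ∀ (e : ι × ι) (S : Set (ι × ι)), ¬ braidFlat S ≤ (coordDiff e).ker →
      Module.finrank ℝ (braidFlat (insert e S)) + 1 = Module.finrank ℝ (braidFlat S) := by
    intro e S h
    rw [braidFlat_insert]
    exact Submodule.finrank_inf_ker_add_one _ _ h
  induction A generalizing S with
  | nil => exact absurd rfl hA
  | cons e A ih =>
    by_cases hS : braidFlat S ≤ (coordDiff e).ker
    · have h1 : braidFlat (insert e S) = braidFlat S := by
        rw [braidFlat_insert]; exact inf_eq_left.2 hS
      have h2 : ∀ (A : List (ι × ι)) (S T : Set (ι × ι)), braidFlat S = braidFlat T →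
          braidCharpoly A S = braidCharpoly A T := by
        intro A
        induction A with
        | nil => intro S T h; rw [braidCharpoly, braidCharpoly, h]
        | cons a A ih =>
          intro S T h
          rw [braidCharpoly, braidCharpoly, ih S T h, ih (insert a S) (insert a T)]
          rw [braidFlat_insert, braidFlat_insert, h]
      rw [braidCharpoly, h2 A _ _ h1, sub_self, List.map_cons,
        regionCount_cons_of_le_ker _ _ fun v hv => hS hv.2]
      simp [alternateUpperSum]
    have hr := rank_insert e S hS
    -- Base case, one functional: of the exponents `m` and `m - 1` exactly one has odd excess over
    -- `d`, and it supplies the `2`.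
    by_cases hA' : A = []
    · subst hA'
      have hN : Module.finrank ℝ (braidFlat S) ≤ Fintype.card ι := by
        simpa using (braidFlat S).finrank_le
      rw [braidCharpoly, braidCharpoly, braidCharpoly, alternateUpperSum_sub,
        alternateUpperSum_X_pow hN, alternateUpperSum_X_pow (by omega)]
      rcases Nat.lt_or_ge d (Module.finrank ℝ (braidFlat S)) with hd | hd
      · rw [step e [] S hS hd]
        have hne : ∀ M : Submodule ℝ (ι → ℝ), regionCount (([] : List (ι × ι)).map coordDiff)
            (M : Set (ι → ℝ)) = 1 := fun M => if_pos ⟨0, M.zero_mem⟩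
        rw [hne, hne]
        generalize Module.finrank ℝ (braidFlat S) = m at *
        generalize Module.finrank ℝ (braidFlat (insert e S)) = m' at *
        obtain ⟨t, rfl⟩ := Nat.exists_eq_add_of_lt hd
        have hm' : m' = d + t := by omega
        subst hm'
        rcases Nat.even_or_odd t with ht | ht
        · rw [if_pos ⟨by omega, by rw [show d + t + 1 - d = t + 1 by omega]; exact ht.add_one⟩,
            if_neg fun h => by
              rw [Nat.add_sub_cancel_left] at h
              exact Nat.not_odd_iff_even.2 ht h.2,
            Even.neg_one_pow (by grind)]
          norm_num
        · rw [if_neg fun h => by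
              rw [show d + t + 1 - d = t + 1 by omega] at h
              exact Nat.not_odd_iff_even.2 ht.add_one h.2,
            if_pos ⟨by have := ht.pos; omega, by rwa [Nat.add_sub_cancel_left]⟩,
            Odd.neg_one_pow (by grind)]
          norm_num
      · rw [zero_case e [] S hd, if_neg (by omega), if_neg (by omega)]
        simp
    · have h1 := ih hA' S
      have h2 := ih hA' (insert e S)
      have hrec : regionCount ((e :: A).map coordDiff)
          ((L ⊓ braidFlat S : Submodule ℝ (ι → ℝ)) : Set (ι → ℝ)) =
        regionCount (A.map coordDiff) ((L ⊓ braidFlat S : Submodule ℝ (ι → ℝ)) : Set (ι → ℝ)) +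
        regionCount (A.map coordDiff)
          ((L ⊓ braidFlat (insert e S) : Submodule ℝ (ι → ℝ)) : Set (ι → ℝ)) := by
        rcases Nat.lt_or_ge d (Module.finrank ℝ (braidFlat S)) with hd | hd
        · exact step e A S hS hd
        · obtain ⟨a, B, rfl⟩ := List.exists_cons_of_ne_nil hA'
          rw [zero_case _ _ _ hd, zero_case _ _ _ hd, zero_case _ _ _ (by omega)]
      rw [hrec, Nat.cast_add, h1, h2, braidCharpoly, alternateUpperSum_sub, ← hr]
      ring

end Flats

/-! ### Stirling numbers of the first kind -/

section Stirling

lemma sum_stirlingFirst_mul_pow {R : Type*} [CommRing R] (k : ℕ) (x : R) :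
    ∑ j ∈ Finset.range (k + 1), (Nat.stirlingFirst k j : R) * x ^ j =
      ∏ i ∈ Finset.range k, (x + i) := by
  induction k with
  | zero => simp
  | succ k ih =>
    rw [Finset.prod_range_succ, ← ih, Finset.sum_range_succ']
    simp only [Nat.stirlingFirst_succ_succ, Nat.stirlingFirst_succ_zero, Nat.cast_add, Nat.cast_mul,
      Nat.cast_zero, zero_mul, add_zero, add_mul, Finset.sum_add_distrib]
    have h : ∑ j ∈ Finset.range (k + 1), (k : R) * (Nat.stirlingFirst k (j + 1) : R) * x ^ (j + 1) =
        k * ∑ j ∈ Finset.range (k + 1), (Nat.stirlingFirst k j : R) * x ^ j := by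
      rw [Finset.sum_range_succ, Nat.stirlingFirst_eq_zero_of_lt k.lt_succ_self,
        Finset.sum_range_succ' _ k, mul_add, Finset.mul_sum]
      have h0 : (k : R) * (Nat.stirlingFirst k 0 : R) = 0 := by
        rcases k with _ | k <;> simp
      simp only [mul_assoc, pow_zero, mul_one, h0, Nat.cast_zero, zero_mul, mul_zero]
    rw [h, mul_add, add_comm, mul_comm _ (k : R), Finset.sum_mul]
    congr 1
    exact Finset.sum_congr rfl fun j _ => by ring

lemma descPochhammer_coeff (k j : ℕ) :
    (descPochhammer ℤ k).coeff j = (-1) ^ (k + j) * (Nat.stirlingFirst k j : ℤ) := by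
  induction k generalizing j with
  | zero => rcases j with _ | j <;> simp [Polynomial.coeff_one]
  | succ k ih =>
    rw [descPochhammer_succ_right, mul_sub, Polynomial.coeff_sub, ← Polynomial.C_eq_natCast,
      Polynomial.coeff_mul_C]
    rcases j with _ | j
    · rw [Polynomial.coeff_mul_X_zero, ih]
      rcases k with _ | k <;> simp
    · rw [Polynomial.coeff_mul_X, ih, ih, Nat.stirlingFirst_succ_succ]
      push_cast
      ring

/-- The rising factorial is `k!` at `1` and, since `k ≥ 2` supplies the factor `x + 1`, zero at
`-1`. A signed sum of the two values keeps, doubled, the indices differing from `d` by an odd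
number. -/
lemma two_mul_sum_stirlingFirst_odd_shift {k d : ℕ} (hk : 2 ≤ k) :
    2 * ∑ j ∈ (Finset.range (k + 1)).filter (fun j => d < j ∧ Odd (j - d)),
        (Nat.stirlingFirst k j : ℤ) +
      2 * ∑ j ∈ (Finset.range d).filter (fun j => Odd (d - j)), (Nat.stirlingFirst k j : ℤ) =
    k.factorial := by
  have h1 := sum_stirlingFirst_mul_pow k (1 : ℤ)
  have h2 := sum_stirlingFirst_mul_pow k (-1 : ℤ)
  rw [Finset.prod_eq_zero (Finset.mem_range.2 (show 1 < k by omega)) (by simp)] at h2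
  have h3 : ∏ i ∈ Finset.range k, ((1 : ℤ) + i) = k.factorial := by
    rw [← Finset.prod_range_add_one_eq_factorial]
    push_cast
    exact Finset.prod_congr rfl fun i _ => add_comm _ _
  rw [h3] at h1
  have h4 : ∑ j ∈ (Finset.range d).filter (fun j => Odd (d - j)), (Nat.stirlingFirst k j : ℤ) =
      ∑ j ∈ (Finset.range (k + 1)).filter (fun j => j < d ∧ Odd (d - j)),
        (Nat.stirlingFirst k j : ℤ) := by
    symm
    apply Finset.sum_subset_zero_on_sdiff
    · intro j; simp
    · intro j hj
      simp only [Finset.mem_sdiff, Finset.mem_filter, Finset.mem_range] at hj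
      rw [Nat.stirlingFirst_eq_zero_of_lt (by
        by_contra hc
        exact hj.2 ⟨by omega, hj.1⟩), Nat.cast_zero]
    · intros; rfl
  have h5 : ∑ j ∈ Finset.range (k + 1), (Nat.stirlingFirst k j : ℤ) * (1 + (-1) ^ (j + d + 1)) =
      k.factorial := by
    simp only [mul_add, Finset.sum_add_distrib, pow_add, ← mul_assoc, ← Finset.sum_mul, h2]
    simpa using h1
  rw [h4, ← h5, Finset.sum_filter, Finset.sum_filter, Finset.mul_sum, Finset.mul_sum,
    ← Finset.sum_add_distrib]
  refine Finset.sum_congr rfl fun j _ => ?_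
  rcases Nat.even_or_odd (j + d) with h | h
  · rw [if_neg, if_neg, h.add_one.neg_one_pow]
    · simp
    · rintro ⟨h1, h2⟩; grind
    · rintro ⟨h1, h2⟩; grind
  · rw [h.add_one.neg_one_pow]
    rcases lt_or_ge d j with hd | hd
    · rw [if_pos ⟨hd, by grind⟩, if_neg (by omega)]
      ring
    · have : j ≠ d := by rintro rfl; grind
      rw [if_neg (by omega), if_pos ⟨by omega, by grind⟩]
      ring

end Stirling

/-! ### Chambers met by a generic subspace -/

section Chambers

lemma exists_pos_forall_pos_add_mul {P : Type*} [Finite P] (a b : P → ℝ) :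
    ∃ ε : ℝ, 0 < ε ∧ ∀ p, 0 < a p → 0 < a p + ε * b p := by
  have h0 : ∀ᶠ ε in nhds (0 : ℝ), ∀ p, 0 < a p → 0 < a p + ε * b p := by
    refine Filter.eventually_all.2 fun p => ?_
    by_cases hp : 0 < a p
    · have hc : Continuous fun ε : ℝ => a p + ε * b p := by fun_prop
      filter_upwards [hc.continuousAt.eventually (lt_mem_nhds (by simpa using hp))] with ε hε _
      exact hε
    · simp [hp]
  obtain ⟨ε, h, hε⟩ := ((h0.filter_mono nhdsWithin_le_nhds).and
    (self_mem_nhdsWithin : Set.Ioi (0 : ℝ) ∈ nhdsWithin 0 (Set.Ioi 0))).exists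
  exact ⟨ε, hε, h⟩

variable {k d : ℕ}

/-- A generic subspace that meets a closed chamber nontrivially meets its interior. -/
lemma GenericForBraid.exists_strictAnti {L : Submodule ℝ (Fin k → ℝ)} (hL : GenericForBraid L d)
    {τ : Equiv.Perm (Fin k)} {v : Fin k → ℝ} (hv : v ∈ L) (hv0 : v ≠ 0) (hτ : Antitone (v ∘ τ)) :
    ∃ β ∈ L, StrictAnti (β ∘ τ) := by
  -- The smallest flat containing `v`; as `L ⊓ K` is nonzero, the dimension count yields `L ⊔ K =
  -- ⊤`.
  set K := braidFlat {e : Fin k × Fin k | v e.1 = v e.2} with hK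
  have hvK : v ∈ K := fun e he => he
  have hpos : 0 < Module.finrank ℝ (L ⊓ K : Submodule ℝ (Fin k → ℝ)) := by
    rw [Nat.pos_iff_ne_zero, Ne, Submodule.finrank_eq_zero]
    intro h
    exact hv0 ((Submodule.mem_bot ℝ).1 (h ▸ (⟨hv, hvK⟩ : v ∈ L ⊓ K)))
  have h1 := hL {e : Fin k × Fin k | v e.1 = v e.2}
  rw [← hK] at h1
  have h2 := hL ∅
  have hflat : braidFlat (∅ : Set (Fin k × Fin k)) = ⊤ := by
    ext β
    exact ⟨fun _ => trivial, fun _ e he => he.elim⟩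
  rw [hflat, inf_top_eq, finrank_top, Module.finrank_fin_fun] at h2
  have h3 := Submodule.finrank_sup_add_finrank_inf_eq L K
  have h4 : Module.finrank ℝ K ≤ k := by simpa using K.finrank_le
  have htop : L ⊔ K = ⊤ := by
    apply Submodule.eq_top_of_finrank_eq
    rw [Module.finrank_fin_fun]
    omega
  -- Split a vector strictly decreasing along `τ` as `l + κ`. Since `κ` respects the ties of `v`,
  -- the summand `l` breaks them in the right order.
  obtain ⟨l, hl, κ, hκ, hu⟩ := Submodule.mem_sup.1
    (htop ▸ Submodule.mem_top : (fun i => -((τ⁻¹ i : Fin k) : ℝ)) ∈ L ⊔ K)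
  obtain ⟨ε, hε, h⟩ := exists_pos_forall_pos_add_mul
    (fun p : Fin k × Fin k => v (τ p.1) - v (τ p.2)) (fun p => l (τ p.1) - l (τ p.2))
  refine ⟨v + ε • l, L.add_mem hv (L.smul_mem ε hl), fun i j hij => ?_⟩
  simp only [Function.comp_apply, Pi.add_apply, Pi.smul_apply, smul_eq_mul]
  rcases (hτ hij.le).lt_or_eq with hlt | heq
  · have := h (i, j) (sub_pos.2 hlt)
    dsimp only at this
    linarith
  · simp only [Function.comp_apply] at heq
    have hκ' : κ (τ i) = κ (τ j) := hκ (τ i, τ j) heq.symm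
    have hi := congrFun hu (τ i)
    have hj := congrFun hu (τ j)
    simp only [Pi.add_apply, show ∀ i, τ⁻¹ (τ i) = i from τ.symm_apply_apply] at hi hj
    have hij' : ((i : ℕ) : ℝ) < ((j : ℕ) : ℝ) := by exact_mod_cast hij
    have : ε * l (τ j) < ε * l (τ i) := by
      apply mul_lt_mul_of_pos_left _ hε
      linarith
    linarith

lemma GenericForBraid.chamber_inter_eq_zero_iff {L : Submodule ℝ (Fin k → ℝ)}
    (hL : GenericForBraid L d) (hk : 2 ≤ k) (τ : Equiv.Perm (Fin k)) :
    (weylChamberA τ : Set (Fin k → ℝ)) ∩ L = {0} ↔ ¬ ∃ β ∈ L, StrictAnti (β ∘ τ) := by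
  constructor
  · rintro h ⟨β, hβ, hs⟩
    have h0 : β = 0 := by
      have : β ∈ (weylChamberA τ : Set (Fin k → ℝ)) ∩ L := ⟨hs.antitone, hβ⟩
      rw [h] at this
      exact this
    subst h0
    have := hs (show (⟨0, by omega⟩ : Fin k) < ⟨1, by omega⟩ from Nat.zero_lt_one)
    exact lt_irrefl _ this
  · intro h
    refine Set.eq_singleton_iff_unique_mem.2 ⟨⟨(weylChamberA τ).zero_mem, L.zero_mem⟩, ?_⟩
    rintro v ⟨hv, hvL⟩
    by_contra hv0
    exact h (hL.exists_strictAnti hvL hv0 hv)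

lemma Set.ncard_image_eq_of_eq_iff {α β γ : Type*} {W : Set α} {f : α → β} {g : α → γ}
    (h : ∀ x ∈ W, ∀ y ∈ W, f x = f y ↔ g x = g y) : (f '' W).ncard = (g '' W).ncard := by
  classical
  rcases isEmpty_or_nonempty α with hα | hα
  · simp [Set.eq_empty_of_isEmpty W]
  have hinv : ∀ x ∈ W, Function.invFunOn g W (g x) ∈ W ∧ g (Function.invFunOn g W (g x)) = g x :=
    fun x hx => ⟨Function.invFunOn_mem ⟨x, hx, rfl⟩, Function.invFunOn_eq ⟨x, hx, rfl⟩⟩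
  have him : f '' W = (f ∘ Function.invFunOn g W) '' (g '' W) := by
    rw [Set.image_image]
    exact Set.image_congr fun x hx => ((h _ (hinv x hx).1 x hx).2 (hinv x hx).2).symm
  rw [him, Set.InjOn.ncard_image]
  rintro _ ⟨x, hx, rfl⟩ _ ⟨y, hy, rfl⟩ hxy
  have := (h _ (hinv x hx).1 _ (hinv y hy).1).1 hxy
  rwa [(hinv x hx).2, (hinv y hy).2] at this

/-- The positive roots of type `A_{k-1}`, as pairs of indices. -/
noncomputable def indexPairs (k : ℕ) : List (Fin k × Fin k) :=
  (Finset.univ.filter fun e : Fin k × Fin k => e.1 < e.2).toList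

@[simp] lemma mem_indexPairs {e : Fin k × Fin k} : e ∈ indexPairs k ↔ e.1 < e.2 := by
  simp [indexPairs]

lemma forall_indexPairs_ne_iff {X : Type*} {c : Fin k → X} :
    (∀ e ∈ indexPairs k, c e.1 ≠ c e.2) ↔ Function.Injective c := by
  constructor
  · intro h i j hij
    by_contra hne
    rcases lt_or_gt_of_ne hne with hlt | hlt
    · exact h (i, j) (mem_indexPairs.2 hlt) hij
    · exact h (j, i) (mem_indexPairs.2 hlt) hij.symm
  · intro h e he heq
    exact (mem_indexPairs.1 he).ne (h heq)

/-- At each natural `q` both polynomials count the injections `Fin k → Fin q`. -/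
lemma braidCharpoly_indexPairs : braidCharpoly (indexPairs k) ∅ = descPochhammer ℤ k := by
  apply Polynomial.eq_of_infinite_eval_eq
  refine (Set.infinite_range_of_injective (Nat.cast_injective (R := ℤ))).mono ?_
  rintro _ ⟨q, rfl⟩
  rw [Set.mem_ofPred_eq, braidCharpoly_eval, descPochhammer_eval_eq_descFactorial]
  simp only [Set.mem_empty_iff_false, false_imp_iff, implies_true, true_and,
    forall_indexPairs_ne_iff]
  have h := Fintype.card_embedding_eq (α := Fin k) (β := Fin q)
  rw [Fintype.card_fin, Fintype.card_fin, ← Nat.card_eq_fintype_card,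
    Nat.card_congr (Equiv.subtypeInjectiveEquivEmbedding (Fin k) (Fin q)).symm] at h
  rw [← h]
  rfl

lemma eq_sort_neg_iff {v : Fin k → ℝ} (hv : Function.Injective v) (τ : Equiv.Perm (Fin k)) :
    τ = Tuple.sort (-v) ↔ StrictAnti (v ∘ τ) := by
  have hanti : ∀ σ : Equiv.Perm (Fin k), StrictAnti (v ∘ σ) ↔ Monotone (-v ∘ σ) := by
    intro σ
    constructor
    · intro h i j hij
      exact neg_le_neg (h.antitone hij)
    · intro h
      have ha : Antitone (v ∘ σ) := fun i j hij => neg_le_neg_iff.1 (h hij)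
      exact ha.strictAnti_of_injective (hv.comp σ.injective)
  rw [hanti]
  constructor
  · rintro rfl
    exact Tuple.monotone_sort (-v)
  · intro h
    have h1 := Tuple.unique_monotone h (Tuple.monotone_sort (-v))
    exact Equiv.ext fun i => hv (neg_injective (congrFun h1 i))

/-- On vectors with distinct coordinates, the sign pattern and the sorting permutation both encode
exactly the order of the coordinates. -/
lemma ncard_chambers_eq_regionCount (L : Submodule ℝ (Fin k → ℝ)) :
    {τ : Equiv.Perm (Fin k) | ∃ β ∈ L, StrictAnti (β ∘ τ)}.ncard =
      regionCount ((indexPairs k).map coordDiff) (L : Set (Fin k → ℝ)) := by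
  have hW : {v ∈ (L : Set (Fin k → ℝ)) | ∀ l ∈ (indexPairs k).map coordDiff, l v ≠ 0} =
      {v | v ∈ L ∧ Function.Injective v} := by
    ext v
    simp only [Set.mem_ofPred_eq, SetLike.mem_coe, List.forall_mem_map, coordDiff_apply, sub_ne_zero,
      forall_indexPairs_ne_iff]
  have hset : {τ : Equiv.Perm (Fin k) | ∃ β ∈ L, StrictAnti (β ∘ τ)} =
      (fun v => Tuple.sort (-v)) '' {v | v ∈ L ∧ Function.Injective v} := by
    ext τ
    constructor
    · rintro ⟨β, hβ, h⟩
      have hinj : Function.Injective β :=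
        (Function.Injective.of_comp_iff' β τ.bijective).1 h.injective
      exact ⟨β, ⟨hβ, hinj⟩, ((eq_sort_neg_iff hinj τ).2 h).symm⟩
    · rintro ⟨β, ⟨hβ, hinj⟩, h⟩
      exact ⟨β, hβ, (eq_sort_neg_iff hinj τ).1 h.symm⟩
  rw [(regionCount_eq_ncard _ _).1, hW, hset]
  refine Set.ncard_image_eq_of_eq_iff ?_
  rintro x ⟨-, hx⟩ y ⟨-, hy⟩
  have hsign : ((indexPairs k).map coordDiff).map (fun l => decide (0 < l x)) =
      ((indexPairs k).map coordDiff).map (fun l => decide (0 < l y)) ↔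
      ∀ i j, x j < x i ↔ y j < y i := by
    simp only [List.map_map, List.map_inj_left, Function.comp_apply, coordDiff_apply, sub_pos,
      decide_eq_decide, mem_indexPairs, Prod.forall]
    constructor
    · intro h i j
      rcases lt_trichotomy i j with hij | rfl | hij
      · exact h i j hij
      · simp
      · have := h j i hij
        rw [← not_le, ← not_le, not_iff_not, (hx.ne hij.ne').le_iff_lt, (hy.ne hij.ne').le_iff_lt]
        exact this
    · exact fun h i j _ => h i j
  rw [hsign, eq_sort_neg_iff hy]
  have hsx := (eq_sort_neg_iff hx _).1 rfl
  constructor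
  · intro h i j
    have hi := hsx.lt_iff_gt (a := (Tuple.sort (-x)).symm j) (b := (Tuple.sort (-x)).symm i)
    have hj := h.lt_iff_gt (a := (Tuple.sort (-x)).symm j) (b := (Tuple.sort (-x)).symm i)
    simp only [Function.comp_apply, Equiv.apply_symm_apply] at hi hj
    rw [hi, hj]
  · intro h i j hij
    exact (h _ _).1 (hsx hij)

lemma GenericForBraid.ncard_chambers {L : Submodule ℝ (Fin k → ℝ)} (hL : GenericForBraid L d)
    (hk : 2 ≤ k) :
    ({τ : Equiv.Perm (Fin k) | (weylChamberA τ : Set (Fin k → ℝ)) ∩ L = {0}}.ncard : ℤ) =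
      2 * ∑ j ∈ (Finset.range d).filter (fun j => Odd (d - j)), (Nat.stirlingFirst k j : ℤ) := by
  have hne : indexPairs k ≠ [] := by
    intro h
    have : ((⟨0, by omega⟩, ⟨1, by omega⟩) : Fin k × Fin k) ∈ indexPairs k :=
      mem_indexPairs.2 Nat.zero_lt_one
    simp [h] at this
  have hflat : braidFlat (∅ : Set (Fin k × Fin k)) = ⊤ := by
    ext β
    exact ⟨fun _ => trivial, fun _ e he => he.elim⟩
  have hr := regionCount_map_coordDiff hL hne ∅
  rw [hflat, inf_top_eq, finrank_top, Module.finrank_fin_fun, braidCharpoly_indexPairs,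
    ← ncard_chambers_eq_regionCount, Fintype.card_fin] at hr
  -- The total sign of the term `j` is `(-1) ^ (2k + d + j + 1)`, which is `1` because `j - d` is
  -- odd.
  have hup : (-1) ^ (k + d + 1) * alternateUpperSum k d (descPochhammer ℤ k) =
      2 * ∑ j ∈ (Finset.range (k + 1)).filter (fun j => d < j ∧ Odd (j - d)),
        (Nat.stirlingFirst k j : ℤ) := by
    rw [alternateUpperSum, mul_left_comm, Finset.mul_sum]
    congr 1
    refine Finset.sum_congr rfl fun j hj => ?_
    obtain ⟨hd, ho⟩ := (Finset.mem_filter.1 hj).2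
    rw [descPochhammer_coeff, ← mul_assoc, ← pow_add, Even.neg_one_pow (by grind), one_mul]
  have hcompl : {τ : Equiv.Perm (Fin k) | (weylChamberA τ : Set (Fin k → ℝ)) ∩ L = {0}} =
      {τ : Equiv.Perm (Fin k) | ∃ β ∈ L, StrictAnti (β ∘ τ)}ᶜ := by
    ext τ
    exact hL.chamber_inter_eq_zero_iff hk τ
  have hsum := Set.ncard_add_ncard_compl {τ : Equiv.Perm (Fin k) | ∃ β ∈ L, StrictAnti (β ∘ τ)}
  rw [Nat.card_perm, Nat.card_fin] at hsum
  have htwo := two_mul_sum_stirlingFirst_odd_shift (d := d) hk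
  rw [hcompl]
  rw [hup] at hr
  zify at hsum
  linarith

end Chambers

/-! ### Faces of Weyl chambers as ordered partitions -/

section Faces

variable {n k d : ℕ}

/-- The cone of all `γ ∘ f` with `γ` antitone. -/
noncomputable def levelCone (f : Fin n → Fin k) : PointedCone ℝ (Fin n → ℝ) :=
  (weylChamberA (1 : Equiv.Perm (Fin k))).map (LinearMap.funLeft ℝ ℝ f)

lemma mem_levelCone {f : Fin n → Fin k} {β : Fin n → ℝ} :
    β ∈ levelCone f ↔ ∃ γ : Fin k → ℝ, Antitone γ ∧ γ ∘ f = β := by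
  rw [levelCone, PointedCone.mem_map]
  rfl

lemma antitone_of_comp_mem_weylChamberA {σ : Equiv.Perm (Fin n)} {f : Fin n → Fin k}
    (hf : Function.Surjective f) (hm : Monotone (f ∘ σ)) {γ : Fin k → ℝ}
    (h : γ ∘ f ∈ weylChamberA σ) : Antitone γ := by
  intro p q hpq
  obtain ⟨i, rfl⟩ := (hf.comp σ.surjective) p
  obtain ⟨j, rfl⟩ := (hf.comp σ.surjective) q
  rcases hpq.eq_or_lt with heq | hlt
  · rw [heq]
  · exact h i j (le_of_not_ge fun hji => absurd (hm hji) (not_le.2 hlt))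

lemma levelCone_le_weylChamberA {σ : Equiv.Perm (Fin n)} {f : Fin n → Fin k}
    (hm : Monotone (f ∘ σ)) : levelCone f ≤ weylChamberA σ := by
  intro β hβ
  obtain ⟨γ, hγ, rfl⟩ := mem_levelCone.1 hβ
  exact fun i j hij => hγ (hm hij)

lemma mem_levelCone_of_mem_weylChamberA {σ : Equiv.Perm (Fin n)} {f : Fin n → Fin k}
    (hf : Function.Surjective f) (hm : Monotone (f ∘ σ)) {β : Fin n → ℝ} (hβ : β ∈ weylChamberA σ)
    (hc : ∀ i j, f i = f j → β i = β j) : β ∈ levelCone f := by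
  have heq : (β ∘ Function.surjInv hf) ∘ f = β :=
    funext fun i => hc _ _ (Function.surjInv_eq hf (f i))
  exact mem_levelCone.2
    ⟨_, antitone_of_comp_mem_weylChamberA hf hm (by rwa [heq]), heq⟩

/-- A strictly decreasing vector stays antitone after a small perturbation, so each `γ ∘ f` is a
multiple of a difference of two elements of the cone. -/
lemma span_levelCone {f : Fin n → Fin k} :
    Submodule.span ℝ (levelCone f : Set (Fin n → ℝ)) = LinearMap.range (LinearMap.funLeft ℝ ℝ f) := by
  apply le_antisymm
  · rw [Submodule.span_le]
    intro β hβ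
    obtain ⟨γ, -, rfl⟩ := mem_levelCone.1 hβ
    exact ⟨γ, rfl⟩
  · rintro _ ⟨γ, rfl⟩
    obtain ⟨ε, hε, h⟩ := exists_pos_forall_pos_add_mul
      (fun p : Fin k × Fin k => ((p.2 : ℕ) : ℝ) - ((p.1 : ℕ) : ℝ)) (fun p => γ p.1 - γ p.2)
    have h1 : (fun p : Fin k => -((p : ℕ) : ℝ)) ∘ f ∈ levelCone f :=
      mem_levelCone.2 ⟨_, fun p q hpq => neg_le_neg (by exact_mod_cast hpq), rfl⟩
    have h2 : (fun p : Fin k => -((p : ℕ) : ℝ) + ε * γ p) ∘ f ∈ levelCone f := by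
      refine mem_levelCone.2 ⟨_, fun p q hpq => ?_, rfl⟩
      rcases hpq.eq_or_lt with rfl | hlt
      · exact le_rfl
      · have := h (p, q) (sub_pos.2 (by exact_mod_cast hlt))
        dsimp only at this ⊢
        linarith
    have h3 : LinearMap.funLeft ℝ ℝ f γ = ε⁻¹ • ((fun p : Fin k => -((p : ℕ) : ℝ) + ε * γ p) ∘ f -
        (fun p : Fin k => -((p : ℕ) : ℝ)) ∘ f) := by
      ext i
      simp [LinearMap.funLeft_apply, hε.ne']
    rw [h3]
    exact Submodule.smul_mem _ _ (Submodule.sub_mem _ (Submodule.subset_span h2)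
      (Submodule.subset_span h1))

lemma finrank_span_levelCone {f : Fin n → Fin k} (hf : Function.Surjective f) :
    Module.finrank ℝ (Submodule.span ℝ (levelCone f : Set (Fin n → ℝ))) = k := by
  rw [span_levelCone, LinearMap.finrank_range_of_inj
    (LinearMap.funLeft_injective_of_surjective _ _ _ hf), Module.finrank_fin_fun]

lemma isFaceOf_levelCone {σ : Equiv.Perm (Fin n)} {f : Fin n → Fin k}
    (hf : Function.Surjective f) (hm : Monotone (f ∘ σ)) :
    (levelCone f).IsFaceOf (weylChamberA σ) := by
  refine ⟨levelCone_le_weylChamberA hm, fun {x y a} hx hy ha hxy => ?_⟩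
  refine mem_levelCone_of_mem_weylChamberA hf hm hx ?_
  obtain ⟨γ, -, hγ⟩ := mem_levelCone.1 hxy
  -- Both `x` and `y` weakly decrease along `σ`, so a tie in `a • x + y` forces a tie in `x`.
  have key : ∀ i j, i ≤ j → f (σ i) = f (σ j) → x (σ i) = x (σ j) := by
    intro i j hij hfij
    have h1 : a * x (σ i) + y (σ i) = a * x (σ j) + y (σ j) := by
      have hi := congrFun hγ (σ i)
      have hj := congrFun hγ (σ j)
      simp only [Function.comp_apply, Pi.add_apply, Pi.smul_apply, smul_eq_mul] at hi hj
      rw [← hi, ← hj, hfij]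
    have h2 := hx i j hij
    have h3 := hy i j hij
    have h4 := mul_le_mul_of_nonneg_left h2 ha.le
    exact mul_left_cancel₀ ha.ne' (by linarith)
  intro i j hij
  obtain ⟨i, rfl⟩ := σ.surjective i
  obtain ⟨j, rfl⟩ := σ.surjective j
  rcases le_total i j with h | h
  · exact key i j h hij
  · exact (key j i h hij.symm).symm

lemma exists_surjective_le_iff_ge (x : Fin n → ℝ) : ∃ (m : ℕ) (f : Fin n → Fin m),
    Function.Surjective f ∧ ∀ i j, f i ≤ f j ↔ x j ≤ x i := by
  classical
  let e := (Finset.univ.image x).orderIsoOfFin rfl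
  refine ⟨_, fun i => Fin.rev (e.symm ⟨x i, Finset.mem_image_of_mem x (Finset.mem_univ i)⟩), ?_, ?_⟩
  · intro p
    obtain ⟨i, -, hi⟩ := Finset.mem_image.1 (e p.rev).2
    refine ⟨i, ?_⟩
    have : (⟨x i, Finset.mem_image_of_mem x (Finset.mem_univ i)⟩ : Finset.univ.image x) =
      e p.rev := Subtype.ext hi
    dsimp only
    rw [this, OrderIso.symm_apply_apply, Fin.rev_rev]
  · intro i j
    rw [Fin.rev_le_rev, OrderIso.le_iff_le, Subtype.mk_le_mk]

/-- A cone inside a chamber contains a vector with as few coincidences as possible. -/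
lemma exists_mem_forall_eq_imp {σ : Equiv.Perm (Fin n)} {F : PointedCone ℝ (Fin n → ℝ)}
    (hF : F ≤ weylChamberA σ) : ∃ x ∈ F, ∀ i j, x i = x j → ∀ y ∈ F, y i = y j := by
  have hz : ∀ p : Fin n × Fin n, ∃ z ∈ F, (∃ y ∈ F, y p.1 ≠ y p.2) → z p.1 ≠ z p.2 := by
    intro p
    by_cases h : ∃ y ∈ F, y p.1 ≠ y p.2
    · obtain ⟨y, hy, hne⟩ := h
      exact ⟨y, hy, fun _ => hne⟩
    · exact ⟨0, F.zero_mem, fun h' => absurd h' h⟩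
  choose z hzF hz using hz
  -- Inside the chamber the coordinate differences of all `z p` have the same sign, so nothing
  -- cancels in the sum.
  have key : ∀ i j, i ≤ j → (∑ p, z p) (σ i) = (∑ p, z p) (σ j) → ∀ p, z p (σ i) = z p (σ j) := by
    intro i j hij h p
    rw [Finset.sum_apply, Finset.sum_apply] at h
    exact ((Finset.sum_eq_sum_iff_of_le fun p _ => hF (hzF p) i j hij).1 h.symm p
      (Finset.mem_univ p)).symm
  refine ⟨∑ p, z p, Submodule.sum_mem _ fun p _ => hzF p, fun i j hij y hy => ?_⟩
  by_contra hne
  refine hz (i, j) ⟨y, hy, hne⟩ ?_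
  dsimp only
  obtain ⟨i, rfl⟩ := σ.surjective i
  obtain ⟨j, rfl⟩ := σ.surjective j
  rcases le_total i j with h | h
  · exact key i j h hij _
  · exact (key j i h hij.symm _).symm

/-- Take `f` from the level sets of a vector `x` of `F` with fewest ties. Any `y` in the cone of `f`
leaves `x - ε • y` in the chamber for small `ε > 0`, so the face property puts `y` in `F`. -/
lemma exists_eq_levelCone {σ : Equiv.Perm (Fin n)} {F : PointedCone ℝ (Fin n → ℝ)}
    (hF : F.IsFaceOf (weylChamberA σ)) : ∃ (m : ℕ) (f : Fin n → Fin m),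
    Function.Surjective f ∧ Monotone (f ∘ σ) ∧ F = levelCone f := by
  obtain ⟨x, hxF, hx⟩ := exists_mem_forall_eq_imp hF.le
  obtain ⟨m, f, hf, hfx⟩ := exists_surjective_le_iff_ge x
  have hxC := hF.le hxF
  have hm : Monotone (f ∘ σ) := fun i j hij => (hfx _ _).2 (hxC i j hij)
  have heq : ∀ i j, f i = f j → x i = x j := fun i j h =>
    le_antisymm ((hfx j i).1 h.ge) ((hfx i j).1 h.le)
  refine ⟨m, f, hf, hm, le_antisymm (fun y hy => ?_) (fun y hy => ?_)⟩
  · exact mem_levelCone_of_mem_weylChamberA hf hm (hF.le hy)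
      fun i j hij => hx i j (heq i j hij) y hy
  · have hyC := levelCone_le_weylChamberA hm hy
    obtain ⟨γ, hγ, rfl⟩ := mem_levelCone.1 hy
    obtain ⟨ε, hε, h⟩ := exists_pos_forall_pos_add_mul
      (fun p : Fin n × Fin n => x (σ p.1) - x (σ p.2))
      (fun p => (γ ∘ f) (σ p.2) - (γ ∘ f) (σ p.1))
    have hdiff : x - ε • (γ ∘ f) ∈ weylChamberA σ := by
      intro i j hij
      simp only [Pi.sub_apply, Pi.smul_apply, smul_eq_mul]
      rcases (hxC i j hij).lt_or_eq with hlt | he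
      · have := h (i, j) (sub_pos.2 hlt)
        dsimp only at this
        linarith
      · have hfe : f (σ j) = f (σ i) := le_antisymm ((hfx _ _).2 he.ge) ((hfx _ _).2 he.le)
        simp only [Function.comp_apply, he, hfe, le_refl]
    exact hF.mem_of_smul_add_mem hyC hdiff hε (by rwa [add_sub_cancel])

lemma facesOfDim_weylChamberA (σ : Equiv.Perm (Fin n)) :
    facesOfDim k (weylChamberA σ) =
      levelCone '' {f : Fin n → Fin k | Function.Surjective f ∧ Monotone (f ∘ σ)} := by
  ext F
  constructor
  · rintro ⟨hF, hdim⟩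
    obtain ⟨m, f, hf, hm, rfl⟩ := exists_eq_levelCone hF
    rw [finrank_span_levelCone hf] at hdim
    subst hdim
    exact ⟨f, ⟨hf, hm⟩, rfl⟩
  · rintro ⟨f, ⟨hf, hm⟩, rfl⟩
    exact ⟨isFaceOf_levelCone hf hm, finrank_span_levelCone hf⟩

/-- Pulling back a strictly decreasing vector recovers the preorder of `f`; equal preorders differ
by a strictly monotone self-map of `Fin k`, the identity. -/
lemma levelCone_injOn :
    Set.InjOn levelCone {f : Fin n → Fin k | Function.Surjective f} := by
  have key : ∀ f g : Fin n → Fin k, levelCone f = levelCone g → ∀ i j, f i < f j → g i < g j := by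
    intro f g h i j hij
    have hmem : (fun p : Fin k => -((p : ℕ) : ℝ)) ∘ f ∈ levelCone g := by
      rw [← h]
      exact mem_levelCone.2 ⟨_, fun p q hpq => neg_le_neg (by exact_mod_cast hpq), rfl⟩
    obtain ⟨γ, hγ, he⟩ := mem_levelCone.1 hmem
    by_contra hcon
    have h1 := hγ (not_lt.1 hcon)
    have hi := congrFun he i
    have hj := congrFun he j
    simp only [Function.comp_apply] at hi hj
    rw [hi, hj, neg_le_neg_iff] at h1
    exact absurd hij (not_lt.2 (by exact_mod_cast h1))
  intro f hf g hg h
  have hlt : ∀ i j, f i < f j ↔ g i < g j := fun i j => ⟨key f g h i j, key g f h.symm i j⟩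
  have hfg : ∀ i j, f i = f j → g i = g j := fun i j hij =>
    le_antisymm (not_lt.1 fun h' => ((hlt j i).2 h').ne hij.symm)
      (not_lt.1 fun h' => ((hlt i j).2 h').ne hij)
  have hgf : (g ∘ Function.surjInv hf) ∘ f = g :=
    funext fun i => hfg _ _ (Function.surjInv_eq hf (f i))
  have hmono : StrictMono (g ∘ Function.surjInv hf) := by
    intro p q hpq
    refine (hlt _ _).1 ?_
    rwa [Function.surjInv_eq hf, Function.surjInv_eq hf]
  have hid := hmono.eq_id
  rw [hid] at hgf
  exact hgf

lemma ncard_faces_inter_eq_zero (L : Submodule ℝ (Fin n → ℝ)) (σ : Equiv.Perm (Fin n)) :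
    Set.ncard {F ∈ facesOfDim k (weylChamberA σ) |
      (F : Set (Fin n → ℝ)) ∩ (L : Set (Fin n → ℝ)) = {0}} =
    Set.ncard {f : Fin n → Fin k | Function.Surjective f ∧ Monotone (f ∘ σ) ∧
      (levelCone f : Set (Fin n → ℝ)) ∩ L = {0}} := by
  have h : {F ∈ facesOfDim k (weylChamberA σ) |
      (F : Set (Fin n → ℝ)) ∩ (L : Set (Fin n → ℝ)) = {0}} =
      levelCone '' {f : Fin n → Fin k | Function.Surjective f ∧ Monotone (f ∘ σ) ∧
      (levelCone f : Set (Fin n → ℝ)) ∩ L = {0}} := by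
    rw [facesOfDim_weylChamberA]
    ext F
    constructor
    · rintro ⟨⟨f, ⟨hf, hm⟩, rfl⟩, hL⟩
      exact ⟨f, ⟨hf, hm, hL⟩, rfl⟩
    · rintro ⟨f, ⟨hf, hm, hL⟩, rfl⟩
      exact ⟨⟨f, ⟨hf, hm⟩, rfl⟩, hL⟩
  rw [h, Set.InjOn.ncard_image (levelCone_injOn.mono fun f hf => hf.1)]

lemma levelCone_inter_eq_zero_iff (L : Submodule ℝ (Fin n → ℝ)) {f : Fin n → Fin k}
    (hf : Function.Surjective f) (τ : Equiv.Perm (Fin k)) :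
    (levelCone (τ.symm ∘ f) : Set (Fin n → ℝ)) ∩ L = {0} ↔
      (weylChamberA τ : Set (Fin k → ℝ)) ∩ (L.comap (LinearMap.funLeft ℝ ℝ f)) = {0} := by
  have hinj := LinearMap.funLeft_injective_of_surjective ℝ ℝ f hf
  have himg : (levelCone (τ.symm ∘ f) : Set (Fin n → ℝ)) ∩ L = LinearMap.funLeft ℝ ℝ f ''
      ((weylChamberA τ : Set (Fin k → ℝ)) ∩ (L.comap (LinearMap.funLeft ℝ ℝ f))) := by
    ext β
    constructor
    · rintro ⟨hβ, hL⟩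
      obtain ⟨γ, hγ, rfl⟩ := mem_levelCone.1 hβ
      refine ⟨γ ∘ τ.symm, ⟨?_, hL⟩, rfl⟩
      intro i j hij
      simpa using hγ hij
    · rintro ⟨γ, ⟨hγ, hL⟩, rfl⟩
      refine ⟨mem_levelCone.2 ⟨γ ∘ τ, fun i j hij => hγ i j hij, ?_⟩, hL⟩
      ext i
      simp [LinearMap.funLeft_apply]
  rw [himg]
  constructor
  · intro h
    apply hinj.image_injective
    rw [h, Set.image_singleton, map_zero]
  · intro h
    rw [h, Set.image_singleton, map_zero]

/-- General position passes to the coordinates on the span of a face. -/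
lemma InGeneralPosition.genericForBraid_comap {L : Submodule ℝ (Fin n → ℝ)}
    (hL : InGeneralPosition (reflectionArrangementA n) L d) {f : Fin n → Fin k}
    (hf : Function.Surjective f) : GenericForBraid (L.comap (LinearMap.funLeft ℝ ℝ f)) d := by
  intro S
  have hinj := LinearMap.funLeft_injective_of_surjective ℝ ℝ f hf
  have hmem : (braidFlat S).map (LinearMap.funLeft ℝ ℝ f) ∈
      arrangementLattice (reflectionArrangementA n) := by
    -- The embedded flat is the intersection of all the hyperplanes containing it.
    refine ⟨{H | H ∈ reflectionArrangementA n ∧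
      (braidFlat S).map (LinearMap.funLeft ℝ ℝ f) ≤ H}, fun H hH => hH.1, ?_⟩
    apply le_antisymm
    · exact le_sInf fun H hH => hH.2
    · intro β hβ
      have hpair : ∀ i j, (∀ γ ∈ braidFlat S, γ (f i) = γ (f j)) → β i = β j := by
        have hlt : ∀ i j, i < j → (∀ γ ∈ braidFlat S, γ (f i) = γ (f j)) → β i = β j := by
          intro i j hij h
          have hle : (braidFlat S).map (LinearMap.funLeft ℝ ℝ f) ≤ equalCoordHyperplane i j := by
            rintro _ ⟨γ, hγ, rfl⟩
            exact h γ hγ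
          exact (Submodule.mem_sInf.1 hβ) _ ⟨⟨i, j, hij, rfl⟩, hle⟩
        intro i j h
        rcases lt_trichotomy i j with hij | rfl | hij
        · exact hlt i j hij h
        · rfl
        · exact (hlt j i hij fun γ hγ => (h γ hγ).symm).symm
      refine ⟨β ∘ Function.surjInv hf, ?_, ?_⟩
      · intro e he
        refine hpair _ _ fun γ hγ => ?_
        rw [Function.surjInv_eq hf, Function.surjInv_eq hf]
        exact hγ e he
      · ext i
        refine hpair _ _ fun γ _ => ?_
        rw [Function.surjInv_eq hf]
  have hmap : (L.comap (LinearMap.funLeft ℝ ℝ f) ⊓ braidFlat S).map (LinearMap.funLeft ℝ ℝ f) =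
      L ⊓ (braidFlat S).map (LinearMap.funLeft ℝ ℝ f) := by
    ext β
    constructor
    · rintro ⟨γ, ⟨hγL, hγ⟩, rfl⟩
      exact ⟨hγL, γ, hγ, rfl⟩
    · rintro ⟨hβ, γ, hγ, rfl⟩
      exact ⟨γ, ⟨hβ, hγ⟩, rfl⟩
  rw [(Submodule.equivMapOfInjective _ hinj _).finrank_eq, hmap,
    (Submodule.equivMapOfInjective _ hinj (braidFlat S)).finrank_eq]
  rcases le_total d (Module.finrank ℝ ((braidFlat S).map (LinearMap.funLeft ℝ ℝ f))) with h | h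
  · exact (hL _ hmem).1 h
  · rw [(hL _ hmem).2 h]
    omega

end Faces

/-! ### Counting monotone surjections -/

section MonotoneSurjections

/-- The number of elements of `D` before `i`. -/
def countBelow {m : ℕ} (D : Finset (Fin m)) (i : Fin (m + 1)) : ℕ :=
  (D.filter fun j => j.castSucc < i).card

lemma countBelow_zero {m : ℕ} (D : Finset (Fin m)) : countBelow D 0 = 0 := by
  simp [countBelow]

lemma countBelow_last {m : ℕ} (D : Finset (Fin m)) : countBelow D (Fin.last m) = D.card := by
  simp [countBelow, Fin.castSucc_lt_last]

lemma countBelow_succ {m : ℕ} (D : Finset (Fin m)) (i : Fin m) :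
    countBelow D i.succ = countBelow D i.castSucc + if i ∈ D then 1 else 0 := by
  simp only [countBelow, Fin.castSucc_lt_succ_iff, Fin.castSucc_lt_castSucc_iff]
  split_ifs with h
  · rw [← Finset.card_insert_of_notMem (a := i) (by simp)]
    congr 1
    ext j
    simp only [Finset.mem_filter, Finset.mem_insert]
    constructor
    · rintro ⟨hj, hle⟩
      exact hle.eq_or_lt.imp id fun hlt => ⟨hj, hlt⟩
    · rintro (rfl | ⟨hj, hlt⟩)
      · exact ⟨h, le_rfl⟩
      · exact ⟨hj, hlt.le⟩
  · rw [add_zero]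
    congr 1
    ext j
    simp only [Finset.mem_filter]
    refine and_congr_right fun hj => ⟨fun hle => lt_of_le_of_ne hle ?_, le_of_lt⟩
    rintro rfl
    exact h hj

lemma countBelow_mono {m : ℕ} (D : Finset (Fin m)) : Monotone (countBelow D) := fun _ _ hij =>
  Finset.card_le_card fun _ hx => Finset.mem_filter.2
    ⟨(Finset.mem_filter.1 hx).1, (Finset.mem_filter.1 hx).2.trans_le hij⟩

lemma exists_countBelow_eq {m : ℕ} (D : Finset (Fin m)) (i : Fin (m + 1)) (p : ℕ)
    (hp : p ≤ countBelow D i) : ∃ j, countBelow D j = p := by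
  induction i using Fin.induction with
  | zero =>
    rw [countBelow_zero] at hp
    exact ⟨0, by rw [countBelow_zero]; omega⟩
  | succ i ih =>
    rcases hp.eq_or_lt with h | h
    · exact ⟨_, h.symm⟩
    · refine ih ?_
      rw [countBelow_succ] at h
      split_ifs at h <;> omega

/-- The jumps of `g`. -/
def jumpSet {m l : ℕ} (g : Fin (m + 1) → Fin (l + 1)) : Finset (Fin m) :=
  Finset.univ.filter fun i => g i.castSucc ≠ g i.succ

lemma countBelow_jumpSet {m l : ℕ} {g : Fin (m + 1) → Fin (l + 1)} (hm : Monotone g)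
    (hs : Function.Surjective g) (i : Fin (m + 1)) : countBelow (jumpSet g) i = g i := by
  induction i using Fin.induction with
  | zero =>
    obtain ⟨i, hi⟩ := hs 0
    have : g 0 = 0 := Fin.le_zero_iff.1 (hi ▸ hm (Fin.zero_le i))
    rw [countBelow_zero, this]
    rfl
  | succ i ih =>
    rw [countBelow_succ, ih]
    simp only [jumpSet, Finset.mem_filter, Finset.mem_univ, true_and]
    by_cases h : g i.castSucc = g i.succ
    · rw [if_neg (not_not.2 h), h, add_zero]
    · rw [if_pos h]
      have hlt : g i.castSucc < g i.succ := lt_of_le_of_ne (hm i.castSucc_lt_succ.le) h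
      refine le_antisymm hlt (not_lt.1 fun hgap => ?_)
      -- A jump by more than one would skip this value, contradicting surjectivity.
      obtain ⟨j, hj⟩ := hs ⟨(g i.castSucc : ℕ) + 1, lt_trans hgap (g i.succ).2⟩
      rcases le_or_gt j i.castSucc with hji | hji
      · have := hm hji
        rw [hj, Fin.le_def] at this
        dsimp only at this
        omega
      · have := hm (Fin.castSucc_lt_iff_succ_le.1 hji)
        rw [hj, Fin.le_def] at this
        dsimp only at this
        omega

/-- A monotone surjection is determined by its jumps, an arbitrary `l`-subset of the `m` gaps. -/
lemma ncard_monotone_surjective (m l : ℕ) :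
    {g : Fin (m + 1) → Fin (l + 1) | Function.Surjective g ∧ Monotone g}.ncard = m.choose l := by
  have hinj : Set.InjOn jumpSet
      {g : Fin (m + 1) → Fin (l + 1) | Function.Surjective g ∧ Monotone g} := by
    rintro g ⟨hgs, hgm⟩ h ⟨hhs, hhm⟩ heq
    ext i
    rw [← countBelow_jumpSet hgm hgs, ← countBelow_jumpSet hhm hhs, heq]
  have himg : jumpSet '' {g : Fin (m + 1) → Fin (l + 1) | Function.Surjective g ∧ Monotone g} =
      ((Finset.univ : Finset (Fin m)).powersetCard l : Set (Finset (Fin m))) := by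
    ext D
    rw [Finset.mem_coe, Finset.mem_powersetCard]
    constructor
    · rintro ⟨g, ⟨hs, hm⟩, rfl⟩
      refine ⟨Finset.subset_univ _, ?_⟩
      obtain ⟨i, hi⟩ := hs (Fin.last l)
      have hlast : g (Fin.last m) = Fin.last l := Fin.last_le_iff.1 (hi ▸ hm (Fin.le_last i))
      rw [← countBelow_last, countBelow_jumpSet hm hs, hlast, Fin.val_last]
    · rintro ⟨-, hD⟩
      have hlt : ∀ i, countBelow D i < l + 1 := fun i => Nat.lt_succ_of_le
        (hD ▸ Finset.card_le_card (Finset.filter_subset _ _))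
      refine ⟨fun i => ⟨countBelow D i, hlt i⟩, ⟨fun p => ?_, fun i j hij => countBelow_mono D hij⟩,
        ?_⟩
      · obtain ⟨j, hj⟩ := exists_countBelow_eq D (Fin.last m) p
          (by rw [countBelow_last, hD]; exact Nat.le_of_lt_succ p.2)
        exact ⟨j, Fin.ext hj⟩
      · ext i
        simp only [jumpSet, Finset.mem_filter, Finset.mem_univ, true_and, ne_eq, Fin.mk.injEq,
          countBelow_succ]
        split_ifs with h <;> simp [h]
  rw [← hinj.ncard_image, himg, Set.ncard_coe_finset, Finset.card_powersetCard, Finset.card_univ,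
    Fintype.card_fin]

end MonotoneSurjections

/-! ### Averaging over permutations and relabellings -/

section Average

variable {n k d : ℕ}

/-- Every monotone rearrangement of `f` equals `f ∘ Tuple.sort f`, so such `σ` form a coset of the
stabilizer. -/
lemma card_monotone_comp_perm (f : Fin n → Fin k) :
    Nat.card {σ : Equiv.Perm (Fin n) // Monotone (f ∘ σ)} =
      Nat.card {ρ : Equiv.Perm (Fin n) // f ∘ ρ = f} := by
  refine Nat.card_congr (Equiv.subtypeEquiv (Equiv.mulRight (Tuple.sort f)⁻¹) fun σ => ?_)
  rw [← Tuple.comp_sort_eq_comp_iff_monotone, Equiv.coe_mulRight, Equiv.Perm.coe_mul,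
    ← Function.comp_assoc]
  constructor
  · intro h
    rw [h]
    ext i
    simp [Equiv.Perm.inv_def]
  · intro h
    ext i
    have hi := congrFun h (Tuple.sort f i)
    simp only [Function.comp_apply, Equiv.Perm.inv_def, Equiv.symm_apply_apply] at hi
    simp [hi]

lemma card_monotone_comp_perm_comp (τ : Equiv.Perm (Fin k)) (f : Fin n → Fin k) :
    Nat.card {σ : Equiv.Perm (Fin n) // Monotone ((τ ∘ f) ∘ σ)} =
      Nat.card {σ : Equiv.Perm (Fin n) // Monotone (f ∘ σ)} := by
  rw [card_monotone_comp_perm, card_monotone_comp_perm]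
  refine Nat.card_congr (Equiv.subtypeEquivRight fun ρ => ?_)
  rw [Function.comp_assoc]
  exact τ.injective.comp_left.eq_iff

lemma ncard_surjective_monotone_comp (hn : 1 ≤ n) (hk : 1 ≤ k) (σ : Equiv.Perm (Fin n)) :
    {f : Fin n → Fin k | Function.Surjective f ∧ Monotone (f ∘ σ)}.ncard =
      (n - 1).choose (k - 1) := by
  obtain ⟨m, rfl⟩ := Nat.exists_eq_add_of_le' hn
  obtain ⟨l, rfl⟩ := Nat.exists_eq_add_of_le' hk
  rw [Nat.add_sub_cancel, Nat.add_sub_cancel, ← ncard_monotone_surjective]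
  have hinj : Function.Injective fun g : Fin (m + 1) → Fin (l + 1) => g ∘ σ :=
    σ.surjective.injective_comp_right
  rw [← Set.ncard_image_of_injective _ hinj]
  congr 1
  ext g
  constructor
  · rintro ⟨f, ⟨hs, hm⟩, rfl⟩
    exact ⟨hs.comp σ.surjective, hm⟩
  · rintro ⟨hs, hm⟩
    have h : (g ∘ σ.symm) ∘ σ = g := by
      ext i
      simp
    exact ⟨g ∘ σ.symm, ⟨hs.comp σ.symm.surjective, by rwa [h]⟩, h⟩

open Classical in
lemma sum_ncard_surjective_monotone_comp (P : (Fin n → Fin k) → Prop) :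
    ∑ σ : Equiv.Perm (Fin n),
      {f : Fin n → Fin k | Function.Surjective f ∧ Monotone (f ∘ σ) ∧ P f}.ncard =
    ∑ f ∈ Finset.univ.filter (fun f : Fin n → Fin k => Function.Surjective f),
      Nat.card {σ : Equiv.Perm (Fin n) // Monotone (f ∘ σ)} * if P f then 1 else 0 := by
  have h1 : ∀ σ : Equiv.Perm (Fin n),
      {f : Fin n → Fin k | Function.Surjective f ∧ Monotone (f ∘ σ) ∧ P f}.ncard =
      ∑ f ∈ Finset.univ.filter (fun f : Fin n → Fin k => Function.Surjective f),
        (if Monotone (f ∘ σ) then 1 else 0) * if P f then 1 else 0 := by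
    intro σ
    rw [Set.ncard_eq_toFinset_card', Set.toFinset_ofPred, Finset.card_filter, Finset.sum_filter]
    refine Finset.sum_congr rfl fun f _ => ?_
    by_cases h1 : Function.Surjective f <;> by_cases h2 : Monotone (f ∘ σ) <;>
      by_cases h3 : P f <;> simp [h1, h2, h3]
  rw [Finset.sum_congr rfl fun σ _ => h1 σ, Finset.sum_comm]
  refine Finset.sum_congr rfl fun f _ => ?_
  rw [← Finset.sum_mul, ← Finset.card_filter, Nat.card_eq_fintype_card, Fintype.card_subtype]

theorem factorial_mul_sum_ncard_faces (hn : 1 ≤ n) (hk : 2 ≤ k) {L : Submodule ℝ (Fin n → ℝ)}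
    (hgen : InGeneralPosition (reflectionArrangementA n) L d) :
    k.factorial * ∑ σ : Equiv.Perm (Fin n), Set.ncard {F ∈ facesOfDim k (weylChamberA σ) |
      (F : Set (Fin n → ℝ)) ∩ (L : Set (Fin n → ℝ)) = {0}} =
    n.factorial * (n - 1).choose (k - 1) *
      (2 * ∑ j ∈ (Finset.range d).filter (fun j => Odd (d - j)), Nat.stirlingFirst k j) := by
  classical
  set N := 2 * ∑ j ∈ (Finset.range d).filter (fun j => Odd (d - j)), Nat.stirlingFirst k j with hN
  set surj := Finset.univ.filter (fun f : Fin n → Fin k => Function.Surjective f) with hsurj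
  set w : (Fin n → Fin k) → ℕ := fun f => Nat.card {σ : Equiv.Perm (Fin n) // Monotone (f ∘ σ)}
  set P : (Fin n → Fin k) → Prop := fun f => (levelCone f : Set (Fin n → ℝ)) ∩ L = {0}
  -- Double counting with no condition on `f`: each `σ` contributes the same number of faces.
  have hw : ∑ f ∈ surj, w f = n.factorial * (n - 1).choose (k - 1) := by
    have h := sum_ncard_surjective_monotone_comp (n := n) (k := k) fun _ => True
    simp only [and_true, if_true, mul_one, ncard_surjective_monotone_comp hn (by omega : 1 ≤ k),
      Finset.sum_const, Finset.card_univ, Fintype.card_perm, Fintype.card_fin, smul_eq_mul] at h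
    exact h.symm
  have hS : ∑ σ : Equiv.Perm (Fin n), Set.ncard {F ∈ facesOfDim k (weylChamberA σ) |
      (F : Set (Fin n → ℝ)) ∩ (L : Set (Fin n → ℝ)) = {0}} =
      ∑ f ∈ surj, w f * if P f then 1 else 0 := by
    simp only [ncard_faces_inter_eq_zero]
    exact sum_ncard_surjective_monotone_comp P
  have hshift : ∀ τ : Equiv.Perm (Fin k), ∑ f ∈ surj, w f * (if P f then 1 else 0) =
      ∑ f ∈ surj, w f * if P (τ.symm ∘ f) then 1 else 0 := by
    intro τ
    refine Finset.sum_nbij' (fun f => τ ∘ f) (fun f => τ.symm ∘ f) ?_ ?_ ?_ ?_ ?_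
    · intro f hf
      rw [hsurj, Finset.mem_filter] at hf ⊢
      exact ⟨Finset.mem_univ _, τ.surjective.comp hf.2⟩
    · intro f hf
      rw [hsurj, Finset.mem_filter] at hf ⊢
      exact ⟨Finset.mem_univ _, τ.symm.surjective.comp hf.2⟩
    · intro f _
      ext i
      simp
    · intro f _
      ext i
      simp
    · intro f _
      have h : τ.symm ∘ τ ∘ f = f := by
        ext i
        simp
      rw [h, show w (τ ∘ f) = w f from card_monotone_comp_perm_comp τ f]
  -- The relabelled cones of `f` are the chambers of its span, so the count does not depend on `f`.
  have hcount : ∀ f ∈ surj,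
      ∑ τ : Equiv.Perm (Fin k), (if P (τ.symm ∘ f) then 1 else 0) = N := by
    intro f hf
    have hf' : Function.Surjective f := (Finset.mem_filter.1 hf).2
    have h := (hgen.genericForBraid_comap hf').ncard_chambers hk
    rw [Set.ncard_eq_toFinset_card', Set.toFinset_ofPred] at h
    rw [← Finset.card_filter, hN, Finset.filter_congr fun τ _ => levelCone_inter_eq_zero_iff L hf' τ]
    exact_mod_cast h
  calc k.factorial * _ = ∑ τ : Equiv.Perm (Fin k), ∑ f ∈ surj, w f * (if P f then 1 else 0) := by
        rw [hS, Finset.sum_const, Finset.card_univ, Fintype.card_perm, Fintype.card_fin,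
          smul_eq_mul]
    _ = ∑ τ : Equiv.Perm (Fin k), ∑ f ∈ surj, w f * (if P (τ.symm ∘ f) then 1 else 0) :=
        Finset.sum_congr rfl fun τ _ => hshift τ
    _ = ∑ f ∈ surj, w f * N := by
        rw [Finset.sum_comm]
        refine Finset.sum_congr rfl fun f hf => ?_
        rw [← Finset.mul_sum, hcount f hf]
    _ = _ := by rw [← Finset.sum_mul, hw]

end Average

theorem theorem2p6 (n d k : ℕ) (hn : 1 ≤ n) (hk : 2 ≤ k)
    (L : Submodule ℝ (Fin n → ℝ))
    (hcodim : Module.finrank ℝ ((Fin n → ℝ) ⧸ L) = d)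
    (hgen : InGeneralPosition (reflectionArrangementA n) L d) :
    (∀ σ : Equiv.Perm (Fin n), (facesOfDim k (weylChamberA σ)).Finite) ∧
    (1 / (n.factorial : ℝ)) * ∑ σ : Equiv.Perm (Fin n),
        (Set.ncard {F ∈ facesOfDim k (weylChamberA σ) |
          (F : Set (Fin n → ℝ)) ∩ (L : Set (Fin n → ℝ)) = {0}} : ℝ) =
      2 / (k.factorial : ℝ) * ((n - 1).choose (k - 1) : ℝ) *
        ∑ j ∈ (Finset.range d).filter (fun j => Odd (d - j)), (Nat.stirlingFirst k j : ℝ) := by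
  refine ⟨fun σ => ?_, ?_⟩
  · rw [facesOfDim_weylChamberA]
    exact (Set.toFinite _).image _
  · have h := factorial_mul_sum_ncard_faces hn hk hgen
    have hn0 : (n.factorial : ℝ) ≠ 0 := by exact_mod_cast n.factorial_ne_zero
    have hk0 : (k.factorial : ℝ) ≠ 0 := by exact_mod_cast k.factorial_ne_zero
    have h' := congrArg (Nat.cast (R := ℝ)) h
    push_cast at h'
    field_simp
    linarith
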